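/- Theorem 1.9. Let $m\ge 1$ and let $0<k_1<\cdots<k_m<d$ be integers with $\gcd(k_1,\dots,k_m,d)=1$. Put $$A=\begin{pmatrix}1&1&\cdots&1&1\\ 0&k_1&\cdots&k_m&d\end{pmatrix},$$ and index its columns, and the variables $x=(x_0,x_{k_1},\dots,x_{k_m},x_d)$, by $J=\{0,k_1,\dots,k_m,d\}$. For $\alpha=(\alpha_1,\alpha_2)$, the $A$-hypergeometric system with exponent $\alpha$ consists of the equations $$\prod_{v_j>0}\Bigl(\frac{\partial}{\partial x_j}\Bigr)^{v_j}\varphi=\prod_{v_j<0}\Bigl(\frac{\partial}{\partial x_j}\Bigr)^{-v_j}\varphi\qquad\text{for all } v\in\mathbb Z^{J}\text{ with }Av=0,$$ $$\sum_{j\in J}x_j\frac{\partial\varphi}{\partial x_j}=\alpha_1\varphi,\qquad \sum_{j\in J}j\,x_j\frac{\partial\varphi}{\partial x_j}=\alpha_2\varphi .$$ If $\alpha\in\mathbb Z^2$ lies in the Euler–Jacobi cone, that is, $d\alpha_1<\alpha_2<0$, then this system has no nonzero rational solution: the only $\varphi\in\mathbb C(x_0,x_{k_1},\dots,x_{k_m},x_d)$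 satisfying it is $\varphi=0$. -/

import Mathlib

open MvPolynomial

noncomputable section

namespace AHypergeometric

/-- The field `ℂ(x_1, …, x_r)` of rational functions in `r` variables. -/
abbrev RatFun (r : ℕ) : Type := FractionRing (MvPolynomial (Fin r) ℂ)

/-- The inclusion of the polynomials into the rational functions. -/
abbrev ofPoly (r : ℕ) : MvPolynomial (Fin r) ℂ →+* RatFun r :=
  algebraMap (MvPolynomial (Fin r) ℂ) (RatFun r)

/-- Quotient rule applied to the fraction `p / q`. -/
def quotRule {r : ℕ} (j : Fin r) (p q : MvPolynomial (Fin r) ℂ) : RatFun r :=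
  ofPoly r (pderiv j p * q - p * pderiv j q) / ofPoly r q ^ 2

theorem ofPoly_ne_zero {r : ℕ} {q : MvPolynomial (Fin r) ℂ} (hq : q ≠ 0) : ofPoly r q ≠ 0 := by
  simpa using hq

theorem exists_frac {r : ℕ} (φ : RatFun r) :
    ∃ p q : MvPolynomial (Fin r) ℂ, q ≠ 0 ∧ φ = ofPoly r p / ofPoly r q := by
  obtain ⟨p, q, hq, h⟩ := IsFractionRing.div_surjective (A := MvPolynomial (Fin r) ℂ) φ
  exact ⟨p, q, nonZeroDivisors.ne_zero hq, h.symm⟩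

theorem quotRule_congr {r : ℕ} (j : Fin r) {p q p' q' : MvPolynomial (Fin r) ℂ}
    (hq : q ≠ 0) (hq' : q' ≠ 0) (h : ofPoly r p / ofPoly r q = ofPoly r p' / ofPoly r q') :
    quotRule j p q = quotRule j p' q' := by
  have h1 : p * q' = p' * q := by
    rw [div_eq_div_iff (ofPoly_ne_zero hq) (ofPoly_ne_zero hq')] at h
    exact IsFractionRing.injective (MvPolynomial (Fin r) ℂ) (RatFun r) (by simpa using h)
  have h2 : pderiv j p * q' + p * pderiv j q' = pderiv j p' * q + p' * pderiv j q := by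
    have := congrArg (pderiv j) h1
    rwa [pderiv_mul, pderiv_mul] at this
  unfold quotRule
  rw [div_eq_div_iff (pow_ne_zero 2 (ofPoly_ne_zero hq)) (pow_ne_zero 2 (ofPoly_ne_zero hq')),
    ← map_pow, ← map_pow, ← map_mul, ← map_mul]
  refine congrArg (ofPoly r) ?_
  linear_combination (q * q') * h2 - (q * pderiv j q' + q' * pderiv j q) * h1

/-- The value at `φ` of the partial derivative `∂/∂x_j`, by the quotient rule. -/
def partialFun {r : ℕ} (j : Fin r) (φ : RatFun r) : RatFun r :=
  quotRule j (exists_frac φ).choose (exists_frac φ).choose_spec.choose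

theorem partialFun_div {r : ℕ} (j : Fin r) (p : MvPolynomial (Fin r) ℂ)
    {q : MvPolynomial (Fin r) ℂ} (hq : q ≠ 0) :
    partialFun j (ofPoly r p / ofPoly r q) = quotRule j p q := by
  obtain ⟨h1, h2⟩ := (exists_frac (ofPoly r p / ofPoly r q)).choose_spec.choose_spec
  exact quotRule_congr j h1 hq h2.symm

theorem partialFun_add {r : ℕ} (j : Fin r) (φ ψ : RatFun r) :
    partialFun j (φ + ψ) = partialFun j φ + partialFun j ψ := by
  obtain ⟨p, q, hq, rfl⟩ := exists_frac φ
  obtain ⟨s, t, ht, rfl⟩ := exists_frac ψ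
  have hq' := ofPoly_ne_zero hq
  have ht' := ofPoly_ne_zero ht
  have : ofPoly r p / ofPoly r q + ofPoly r s / ofPoly r t
      = ofPoly r (p * t + q * s) / ofPoly r (q * t) := by
    rw [div_add_div _ _ hq' ht']; simp only [map_add, map_mul]
  rw [this, partialFun_div j _ (mul_ne_zero hq ht), partialFun_div j _ hq, partialFun_div j _ ht]
  simp only [quotRule, map_add, map_mul, map_sub, pderiv_mul]
  field_simp
  ring

theorem partialFun_mul {r : ℕ} (j : Fin r) (φ ψ : RatFun r) :
    partialFun j (φ * ψ) = φ * partialFun j ψ + ψ * partialFun j φ := by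
  obtain ⟨p, q, hq, rfl⟩ := exists_frac φ
  obtain ⟨s, t, ht, rfl⟩ := exists_frac ψ
  have hq' := ofPoly_ne_zero hq
  have ht' := ofPoly_ne_zero ht
  have : ofPoly r p / ofPoly r q * (ofPoly r s / ofPoly r t)
      = ofPoly r (p * s) / ofPoly r (q * t) := by
    rw [div_mul_div_comm]; simp only [map_mul]
  rw [this, partialFun_div j _ (mul_ne_zero hq ht), partialFun_div j _ hq, partialFun_div j _ ht]
  simp only [quotRule, map_add, map_mul, map_sub, pderiv_mul]
  field_simp
  ring

theorem partialFun_ofPoly {r : ℕ} (j : Fin r) (p : MvPolynomial (Fin r) ℂ) :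
    partialFun j (ofPoly r p) = ofPoly r (pderiv j p) := by
  have := partialFun_div j p (one_ne_zero (α := MvPolynomial (Fin r) ℂ))
  simpa [quotRule] using this

/-- The partial derivative `∂/∂x_j` as a `ℂ`-linear derivation of `ℂ(x_1, …, x_r)`. -/
def partialD {r : ℕ} (j : Fin r) : Derivation ℂ (RatFun r) (RatFun r) :=
  Derivation.mk'
    { toFun := partialFun j
      map_add' := partialFun_add j
      map_smul' := fun c φ => by
        have h : algebraMap ℂ (RatFun r) c = ofPoly r (C c) :=
          IsScalarTower.algebraMap_apply ℂ (MvPolynomial (Fin r) ℂ) (RatFun r) c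
        rw [Algebra.smul_def, partialFun_mul, h, partialFun_ofPoly, pderiv_C, map_zero, mul_zero,
          add_zero, RingHom.id_apply, Algebra.smul_def, h] }
    (fun φ ψ => partialFun_mul j φ ψ)

/-- The differential operator `∂^{|u|}/∂x^u = ∏_j (∂/∂x_j)^{u_j}`. -/
def monomialD {r : ℕ} (u : Fin r → ℕ) : Module.End ℂ (RatFun r) :=
  (List.ofFn fun j : Fin r => ((partialD j : RatFun r →ₗ[ℂ] RatFun r) : Module.End ℂ (RatFun r))
    ^ u j).prod

/-- The toric operator
`D_v = ∏_{v_j > 0} (∂/∂x_j)^{v_j} - ∏_{v_j < 0} (∂/∂x_j)^{-v_j}`. -/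
def toricD {r : ℕ} (v : Fin r → ℤ) : Module.End ℂ (RatFun r) :=
  monomialD (fun j => (v j).toNat) - monomialD (fun j => (-v j).toNat)

/-- The rational function `φ` is a solution of the `A`-hypergeometric system with exponent `α`:
`D_v φ = 0` for all `v ∈ ℤ^r` with `A v = 0`, and
`∑_j A_{ij} x_j ∂φ/∂x_j = α_i φ` for every row `i`. -/
structure IsRationalSolution {n r : ℕ} (A : Matrix (Fin n) (Fin r) ℤ) (α : Fin n → ℂ)
    (φ : RatFun r) : Prop where
  toric : ∀ v : Fin r → ℤ, A.mulVec v = 0 → toricD v φ = 0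
  euler : ∀ i : Fin n,
    ∑ j : Fin r, (A i j : RatFun r) * ofPoly r (X j) * partialD j φ = α i • φ

/-- The matrix with rows `(1, 1, …, 1, 1)` and `(0, k_1, …, k_m, d)`. -/
def monomialCurveMatrix {m : ℕ} (k : Fin m → ℕ) (d : ℕ) : Matrix (Fin 2) (Fin (m + 2)) ℤ :=
  Matrix.of ![fun _ => 1,
    Fin.cons (α := fun _ => ℤ) 0 (Fin.snoc (α := fun _ => ℤ) (fun i => (k i : ℤ)) (d : ℤ))]

/-- The Euler-Jacobi cone `{(α₁, α₂) ∈ ℤ² : d α₁ < α₂ < 0}`. -/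
def eulerJacobiCone (d : ℕ) : Set (Fin 2 → ℤ) :=
  {α | (d : ℤ) * α 0 < α 1 ∧ α 1 < 0}

end AHypergeometric

end

/-! Suppose `φ ≠ 0`. Of the toric equations only `∂_j^d φ = ∂_0^(d-w) ∂_d^w φ` is needed, for each
intermediate variable `x_j` of weight `w`.

Elimination: the lowest coefficient of the Laurent expansion in an intermediate `x_j` solves the
remaining equations. The toric equation for `j` forces its order `n` to be nonnegative, and the
exponent becomes `(α₁ - n, α₂ - n w)`, which stays in the cone because `0 ≤ w ≤ d`
(`IsReducedSolution.eliminate`). This reduces the problem to three variables, of weights `0 < q < p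
+ q = d`.

Three variables: the Euler equations write `θ_0` and `θ_d` as affine functions of `θ_j`. Multiplying
the toric equation by `x_0^p x_d^q` then gives an ordinary equation `c ∂^d φ = ∏ (θ + e_i) φ` in
`x_j`, with `c ≠ 0` free of `x_j`. The cone condition says exactly that the smallest shifts `e_i` in
the two families are positive.

A pole at `x_j = ρ` requires `ρ^d = c`, and the next coefficient requires its order `M` to satisfy
`∑ (M - i + e_i) = 0` (`order_of_pole`). Here that reads `2M = 2α₁ + 1`, which no integer satisfies.
So `φ` is a polynomial in `x_j`; in its degree `N` the equation gives `∏ (N + e_i) = 0`, which is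
absurd for positive `e_i`. -/

namespace AHypergeometric

/-! ### Differential operators on Laurent series and the local analysis at a pole. -/

section LaurentSeries

variable {F : Type*} [Field F]

/-- The map on Laurent series that applies `D n` to the coefficient of index `n`. -/
def coeffwise (D : ℤ → F → F) (hD : ∀ n, D n 0 = 0) (f : HahnSeries ℤ F) : HahnSeries ℤ F where
  coeff n := D n (f.coeff n)
  isPWO_support' := f.isPWO_support.mono fun n hn h0 => hn (by simp only [h0, hD])

theorem coeff_coeffwise (D : ℤ → F → F) (hD : ∀ n, D n 0 = 0) (f : HahnSeries ℤ F) (n : ℤ) :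
    (coeffwise D hD f).coeff n = D n (f.coeff n) := rfl

theorem support_coeffwise_subset (D : ℤ → F → F) (hD : ∀ n, D n 0 = 0) (f : HahnSeries ℤ F) :
    (coeffwise D hD f).support ⊆ f.support := fun n hn h0 => hn (by
  rw [coeff_coeffwise, h0, hD])

/-- The Leibniz rule is checked on each term `f_i g_j` of the convolution. Letting `D` depend on the
index covers both `T d/dT` and a derivation of the coefficients. -/
theorem coeffwise_mul (D : ℤ → F → F) (hD : ∀ n, D n 0 = 0)
    (hadd : ∀ n a b, D n (a + b) = D n a + D n b)
    (hmul : ∀ i j a b, D (i + j) (a * b) = a * D j b + D i a * b) (f g : HahnSeries ℤ F) :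
    coeffwise D hD (f * g) = f * coeffwise D hD g + coeffwise D hD f * g := by
  ext n
  rw [coeff_coeffwise, HahnSeries.coeff_add, HahnSeries.coeff_mul,
    HahnSeries.coeff_mul_right' g.isPWO_support (support_coeffwise_subset D hD g),
    HahnSeries.coeff_mul_left' f.isPWO_support (support_coeffwise_subset D hD f),
    ← Finset.sum_add_distrib]
  let Dn : F →+ F := ⟨⟨D n, hD n⟩, hadd n⟩
  change Dn _ = _
  rw [map_sum]
  refine Finset.sum_congr rfl fun ij hij => ?_
  rw [Finset.mem_antidiagonal] at hij
  change D n _ = _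
  rw [← hij.2.2, hmul]
  rfl

/-- The derivation `T d/dT` of the Laurent series in `T`. -/
def thetaT (f : HahnSeries ℤ F) : HahnSeries ℤ F :=
  coeffwise (fun n a => (n : F) * a) (fun _ => mul_zero _) f

theorem coeff_thetaT (f : HahnSeries ℤ F) (n : ℤ) :
    (thetaT f).coeff n = (n : F) * f.coeff n := rfl

theorem thetaT_add (f g : HahnSeries ℤ F) : thetaT (f + g) = thetaT f + thetaT g := by
  ext n
  simp only [coeff_thetaT, HahnSeries.coeff_add, mul_add]

theorem thetaT_mul (f g : HahnSeries ℤ F) : thetaT (f * g) = f * thetaT g + thetaT f * g :=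
  coeffwise_mul _ _ (fun n a b => mul_add _ _ _)
    (fun i j a b => by push_cast; ring) f g

/-- The derivation `d/dT` of the Laurent series in `T`. -/
noncomputable def derivT (f : HahnSeries ℤ F) : HahnSeries ℤ F := HahnSeries.single (-1) 1 * thetaT f

theorem coeff_derivT (f : HahnSeries ℤ F) (n : ℤ) :
    (derivT f).coeff n = ((n : F) + 1) * f.coeff (n + 1) := by
  rw [derivT, HahnSeries.coeff_single_mul, one_mul, sub_neg_eq_add, coeff_thetaT]
  push_cast
  rfl

theorem derivT_add (f g : HahnSeries ℤ F) : derivT (f + g) = derivT f + derivT g := by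
  rw [derivT, thetaT_add, mul_add]; rfl

theorem derivT_mul (f g : HahnSeries ℤ F) : derivT (f * g) = f * derivT g + derivT f * g := by
  simp only [derivT, thetaT_mul]; ring

theorem derivT_C (c : F) : derivT (HahnSeries.C c) = 0 := by
  ext n
  rw [coeff_derivT, HahnSeries.C_apply, HahnSeries.coeff_single]
  split_ifs with h
  · have : (n : F) + 1 = 0 := by exact_mod_cast congrArg (Int.cast (R := F)) h
    rw [this, zero_mul]; rfl
  · rw [mul_zero]; rfl

theorem derivT_single_one : derivT (HahnSeries.single 1 1 : HahnSeries ℤ F) = 1 := by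
  ext n
  rw [coeff_derivT, HahnSeries.coeff_single, HahnSeries.coeff_one]
  by_cases h : n = 0
  · simp [h]
  · simp [h]

/-- The operator `(θ + e 0) (θ + e 1) ⋯ (θ + e (n - 1))`. -/
def shiftedProd {R : Type*} [Semiring R] (θ : R → R) (e : ℕ → R) : ℕ → R → R
  | 0, f => f
  | n + 1, f => θ (shiftedProd θ e n f) + e n * shiftedProd θ e n f

/-- The derivation `(a + T) d/dT` of the Laurent series in `T`. -/
noncomputable def thetaAt (a : F) (f : HahnSeries ℤ F) : HahnSeries ℤ F :=
  (HahnSeries.C a + HahnSeries.single 1 1) * derivT f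

theorem coeff_thetaAt (a : F) (f : HahnSeries ℤ F) (n : ℤ) :
    (thetaAt a f).coeff n = a * ((n + 1) * f.coeff (n + 1)) + n * f.coeff n := by
  rw [thetaAt, add_mul, HahnSeries.coeff_add, HahnSeries.coeff_single_mul, HahnSeries.C_apply,
    HahnSeries.coeff_single_mul, coeff_derivT, coeff_derivT]
  simp

theorem coeff_C_mul' (c : F) (f : HahnSeries ℤ F) (n : ℤ) :
    (HahnSeries.C c * f).coeff n = c * f.coeff n := by
  rw [HahnSeries.C_apply, HahnSeries.coeff_single_mul, sub_zero]

theorem coeff_iterate_derivT (f : HahnSeries ℤ F) (d : ℕ) (n : ℤ) :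
    (derivT^[d] f).coeff n = (∏ i ∈ Finset.range d, ((n : F) + d - i)) * f.coeff (n + d) := by
  induction d generalizing n with
  | zero => simp
  | succ d ih =>
    rw [Function.iterate_succ_apply', coeff_derivT, ih, Finset.prod_range_succ]
    push_cast
    have : n + 1 + (d : ℤ) = n + (d + 1) := by ring
    have hprod : ∏ i ∈ Finset.range d, ((n : F) + 1 + d - i) =
        ∏ i ∈ Finset.range d, ((n : F) + (d + 1) - i) :=
      Finset.prod_congr rfl fun i _ => by ring
    rw [this, hprod]
    ring

/-- The two lowest coefficients of `∏ (θ + e i) f`, where `θ = (a + T) d/dT`. -/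
theorem coeff_shiftedProd_thetaAt (a : F) (e : ℕ → F) (f : HahnSeries ℤ F) (M : ℤ)
    (hf : ∀ i < M, f.coeff i = 0) (n : ℕ) :
    (∀ i < M - n, (shiftedProd (thetaAt a) (fun i => HahnSeries.C (e i)) n f).coeff i = 0) ∧
    (shiftedProd (thetaAt a) (fun i => HahnSeries.C (e i)) n f).coeff (M - n) =
      a ^ n * (∏ i ∈ Finset.range n, ((M : F) - i)) * f.coeff M ∧
    ∃ b : F, (shiftedProd (thetaAt a) (fun i => HahnSeries.C (e i)) n f).coeff (M - n + 1) =
      a ^ n * (∏ i ∈ Finset.range n, ((M : F) + 1 - i)) * f.coeff (M + 1) + b * f.coeff M ∧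
      b * (a * (M - n + 1)) = a ^ n * (∏ i ∈ Finset.range n, ((M : F) - i)) *
        ∑ i ∈ Finset.range n, ((M : F) - i + e i) := by
  induction n with
  | zero => exact ⟨by simpa [shiftedProd] using hf, by simp [shiftedProd], 0, by simp [shiftedProd], by simp⟩
  | succ n ih =>
    obtain ⟨h1, h2, b, h3, h4⟩ := ih
    set g := shiftedProd (thetaAt a) (fun i => HahnSeries.C (e i)) n f
    have key : ∀ i, (shiftedProd (thetaAt a) (fun i => HahnSeries.C (e i)) (n + 1) f).coeff i
        = a * ((i + 1) * g.coeff (i + 1)) + (i + e n) * g.coeff i := by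
      intro i
      rw [shiftedProd, HahnSeries.coeff_add, coeff_thetaAt, coeff_C_mul']
      ring
    have e1 : M - ((n + 1 : ℕ) : ℤ) + 1 = M - n := by push_cast; ring
    -- The factor `θ + e n` lowers the order by one. The new `b` collects what it makes of the old
    -- `b` and of the old lowest coefficient. Multiplying by `a * (M - n + 1)` in the claim avoids
    -- dividing by the last factor of `a ^ n * ∏ (M - i)`.
    refine ⟨fun i hi => ?_, ?_,
      a * (M - n + 1) * b + (M - n + e n) * (a ^ n * ∏ i ∈ Finset.range n, ((M : F) - i)), ?_, ?_⟩
    · push_cast at hi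
      rw [key, h1 _ (by omega), h1 _ (by omega)]; ring
    · rw [key, e1, h2, h1 _ (by push_cast; omega), Finset.prod_range_succ]
      push_cast; ring
    · rw [key, e1, h2, h3, Finset.prod_range_succ]
      push_cast; ring
    · rw [Finset.prod_range_succ, Finset.sum_range_succ]
      push_cast
      linear_combination (a * (M - n)) * h4

/-- The equation `c ∂^d f = ∏ (θ + e i) f` determines the order of a pole of `f`. -/
theorem order_of_pole [CharZero F] (a c : F) (hc : c ≠ 0) (e : ℕ → F) (d : ℕ)
    (f : HahnSeries ℤ F) (M : ℤ) (hM : M < 0) (hf : ∀ i < M, f.coeff i = 0) (hfM : f.coeff M ≠ 0)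
    (h : HahnSeries.C c * derivT^[d] f =
      shiftedProd (thetaAt a) (fun i => HahnSeries.C (e i)) d f) :
    ∑ i ∈ Finset.range d, ((M : F) - i + e i) = 0 := by
  obtain ⟨-, h2, b, h3, h4⟩ := coeff_shiftedProd_thetaAt a e f M hf d
  rw [← h, coeff_C_mul', coeff_iterate_derivT] at h2 h3
  -- `M < 0` is not one of the ordinary exponents `0, …, d - 1`.
  have hP : (∏ i ∈ Finset.range d, ((M : F) - i)) ≠ 0 := by
    refine Finset.prod_ne_zero_iff.2 fun i _ h0 => ?_
    have : M - i = 0 := by exact_mod_cast h0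
    omega
  have e1 : M - (d : ℤ) + d = M := by ring
  have e2 : M - (d : ℤ) + 1 + d = M + 1 := by ring
  rw [e1] at h2
  rw [e2] at h3
  push_cast at h2 h3
  simp only [sub_add_cancel] at h2
  -- The coefficients of index `M - d` agree: a pole can only lie where the leading coefficient `c -
  -- x^d` of the equation vanishes.
  have hac : c = a ^ d := by
    have := mul_right_cancel₀ hfM ((mul_assoc _ _ _).trans h2)
    exact mul_right_cancel₀ hP this
  have had : a ^ d ≠ 0 := hac ▸ hc
  have e3 : ∀ i : ℕ, (M : F) - d + 1 + d - i = M + 1 - i := fun i => by ring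
  simp only [e3] at h3
  -- Since `c = a ^ d`, the unknown `f.coeff (M + 1)` cancels from the coefficients of index `M - d
  -- + 1`.
  have hb : b * f.coeff M = 0 := by rw [hac] at h3; linear_combination -h3
  rw [(mul_eq_zero.1 hb).resolve_right hfM, zero_mul, eq_comm] at h4
  exact (mul_eq_zero.1 h4).resolve_left (mul_ne_zero had hP)

theorem exists_powerSeries (f : HahnSeries ℤ F) (hf : ∀ n < 0, f.coeff n = 0) :
    ∃ g : PowerSeries F, HahnSeries.ofPowerSeries ℤ F g = f := by
  refine ⟨PowerSeries.mk fun n => f.coeff n, ?_⟩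
  ext n
  rcases lt_or_ge n 0 with hn | hn
  · rw [hf n hn, HahnSeries.ofPowerSeries_apply]
    refine HahnSeries.embDomain_of_notMem_range ?_
    rintro ⟨k, hk⟩
    simp at hk
    omega
  · lift n to ℕ using hn
    rw [HahnSeries.ofPowerSeries_apply_coeff, PowerSeries.coeff_mk]

end LaurentSeries

/-! ### Laurent expansions of rational functions in one variable, and their compatibility with
derivatives. -/

section Expansion

variable {r : ℕ}

/-- A derivation along an embedding of `ℂ(x)` in a field is determined by its values on the
constants and the variables. -/
theorem eq_zero_of_leibniz {E : Type*} [CommRing E] [IsDomain E] (f : RatFun r →+* E)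
    (δ : RatFun r → E)
    (hadd : ∀ a b, δ (a + b) = δ a + δ b) (hmul : ∀ a b, δ (a * b) = f a * δ b + δ a * f b)
    (hC : ∀ c, δ (ofPoly r (C c)) = 0) (hX : ∀ i, δ (ofPoly r (X i)) = 0) (φ : RatFun r) :
    δ φ = 0 := by
  have hpoly : ∀ p, δ (ofPoly r p) = 0 := by
    intro p
    induction p using MvPolynomial.induction_on with
    | C c => exact hC c
    | add p q hp hq => rw [map_add, hadd, hp, hq, add_zero]
    | mul_X p i hp => rw [map_mul, hmul, hp, hX, mul_zero, zero_mul, add_zero]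
  obtain ⟨p, q, hq, rfl⟩ := exists_frac φ
  have hq' := ofPoly_ne_zero hq
  have h := hmul (ofPoly r p / ofPoly r q) (ofPoly r q)
  rw [div_mul_cancel₀ _ hq', hpoly, hpoly, mul_zero, zero_add, eq_comm] at h
  exact (mul_eq_zero.1 h).resolve_right ((map_ne_zero f).2 hq')

theorem partialD_ofPoly (j : Fin r) (p : MvPolynomial (Fin r) ℂ) :
    partialD j (ofPoly r p) = ofPoly r (pderiv j p) := partialFun_ofPoly j p

theorem partialD_X_self (j : Fin r) : partialD j (ofPoly r (X j)) = 1 := by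
  rw [partialD_ofPoly, pderiv_X_self, map_one]

theorem partialD_X_of_ne {i j : Fin r} (h : i ≠ j) : partialD j (ofPoly r (X i)) = 0 := by
  rw [partialD_ofPoly, pderiv_X_of_ne h, map_zero]

theorem partialD_C (j : Fin r) (c : ℂ) : partialD j (ofPoly r (C c)) = 0 := by
  rw [partialD_ofPoly, pderiv_C, map_zero]

/-- The commutator is a derivation that kills constants and variables. -/
theorem partialD_comm (i j : Fin r) (φ : RatFun r) :
    partialD i (partialD j φ) = partialD j (partialD i φ) := by
  have h : ∀ i j k : Fin r, partialD i (partialD j (ofPoly r (X k))) = 0 := fun i j k => by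
    rw [partialD_ofPoly, pderiv_X, partialD_ofPoly]
    by_cases h : k = j
    · subst h; simp
    · simp [Pi.single_eq_of_ne' (Ne.symm h)]
  have := eq_zero_of_leibniz (RingHom.id (RatFun r))
    (fun φ => ⁅partialD i, partialD j⁆ φ) (fun a b => map_add _ a b)
    (fun a b => by rw [Derivation.leibniz]; simp only [smul_eq_mul, RingHom.id_apply]; ring)
    (fun c => by rw [Derivation.commutator_apply, partialD_C, partialD_C]; simp)
    (fun k => by rw [Derivation.commutator_apply, h, h, sub_zero]) φ
  rwa [Derivation.commutator_apply, sub_eq_zero] at this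

variable (F : Type*) [Field F] [Algebra (RatFun r) F]

/-- A polynomial in `x_1, …, x_r`, viewed as a polynomial in `x_j` alone. -/
noncomputable def toUnivariate (j : Fin r) : MvPolynomial (Fin r) ℂ →+* Polynomial F :=
  eval₂Hom (Polynomial.C.comp ((algebraMap (RatFun r) F).comp ((ofPoly r).comp C)))
    (Function.update (fun i => Polynomial.C (algebraMap (RatFun r) F (ofPoly r (X i)))) j
      Polynomial.X)

theorem eval_toUnivariate (j : Fin r) (p : MvPolynomial (Fin r) ℂ) :
    (toUnivariate F j p).eval (algebraMap (RatFun r) F (ofPoly r (X j))) =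
      algebraMap (RatFun r) F (ofPoly r p) := by
  induction p using MvPolynomial.induction_on with
  | C c => simp [toUnivariate]
  | add p q hp hq => rw [map_add, Polynomial.eval_add, hp, hq, map_add, map_add]
  | mul_X p i hp =>
    rw [map_mul, Polynomial.eval_mul, hp, map_mul, map_mul]
    congr 1
    by_cases h : i = j
    · subst h; simp [toUnivariate]
    · simp [toUnivariate, Function.update_of_ne h]

/-- Substituting `x_j` back for the polynomial variable recovers the original polynomial. -/
theorem toUnivariate_injective (j : Fin r) : Function.Injective (toUnivariate F j) := by
  refine (injective_iff_map_eq_zero _).2 fun p hp => ?_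
  have h := eval_toUnivariate F j p
  rw [hp, Polynomial.eval_zero, eq_comm, map_eq_zero] at h
  exact (map_eq_zero_iff _ (IsFractionRing.injective (MvPolynomial (Fin r) ℂ) (RatFun r))).1 h

variable {F}

/-- The Taylor expansion at `a` of a polynomial in one variable. -/
noncomputable def taylorSeries (a : F) : Polynomial F →+* PowerSeries F :=
  Polynomial.coeToPowerSeries.ringHom.comp (Polynomial.taylorAlgHom a : Polynomial F →+* _)

theorem taylorSeries_apply (a : F) (p : Polynomial F) :
    taylorSeries a p = (Polynomial.taylor a p : PowerSeries F) := rfl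

theorem constantCoeff_taylorSeries (a : F) (p : Polynomial F) :
    PowerSeries.constantCoeff (taylorSeries a p) = p.eval a := by
  rw [taylorSeries_apply, Polynomial.constantCoeff_coe, Polynomial.taylor_coeff_zero]

theorem taylorSeries_injective (a : F) : Function.Injective (taylorSeries a) := fun _ _ h =>
  Polynomial.taylor_injective a (Polynomial.coe_injective F h)

/-- The Laurent expansion at `x_j = a` of a polynomial in `x_1, …, x_r`. -/
noncomputable def polyExpansion (j : Fin r) (a : F) :
    MvPolynomial (Fin r) ℂ →+* HahnSeries ℤ F :=
  (HahnSeries.ofPowerSeries ℤ F).comp ((taylorSeries a).comp (toUnivariate F j))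

theorem polyExpansion_injective (j : Fin r) (a : F) :
    Function.Injective (polyExpansion j a) :=
  HahnSeries.ofPowerSeries_injective.comp
    ((taylorSeries_injective a).comp (toUnivariate_injective F j))

/-- The Laurent expansion at `x_j = a` of a rational function in `x_1, …, x_r`. -/
noncomputable def expansion (j : Fin r) (a : F) : RatFun r →+* HahnSeries ℤ F :=
  IsFractionRing.lift (polyExpansion_injective j a)

theorem expansion_ofPoly (j : Fin r) (a : F) (p : MvPolynomial (Fin r) ℂ) :
    expansion j a (ofPoly r p) =
      HahnSeries.ofPowerSeries ℤ F (taylorSeries a (toUnivariate F j p)) :=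
  IsFractionRing.lift_algebraMap _ p

theorem expansion_X_self (j : Fin r) (a : F) :
    expansion j a (ofPoly r (X j)) = HahnSeries.C a + HahnSeries.single 1 1 := by
  rw [expansion_ofPoly, taylorSeries_apply]
  simp [toUnivariate, add_comm]

theorem expansion_X_of_ne {i j : Fin r} (h : i ≠ j) (a : F) :
    expansion j a (ofPoly r (X i)) =
      HahnSeries.C (algebraMap (RatFun r) F (ofPoly r (X i))) := by
  rw [expansion_ofPoly, taylorSeries_apply]
  simp [toUnivariate, Function.update_of_ne h]

theorem expansion_C (j : Fin r) (a : F) (c : ℂ) :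
    expansion j a (ofPoly r (C c)) =
      HahnSeries.C (algebraMap (RatFun r) F (ofPoly r (C c))) := by
  rw [expansion_ofPoly, taylorSeries_apply]
  simp [toUnivariate]

/-- The difference of the two sides is a derivation along `expansion j a`, so constants and
variables suffice. -/
theorem expansion_partialD (j : Fin r) (a : F) (φ : RatFun r) :
    expansion j a (partialD j φ) = derivT (expansion j a φ) := by
  rw [← sub_eq_zero]
  refine eq_zero_of_leibniz (expansion j a)
    (fun φ => expansion j a (partialD j φ) - derivT (expansion j a φ))
    (fun φ ψ => ?_) (fun φ ψ => ?_) (fun c => ?_) (fun i => ?_) φ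
  · simp only [map_add, derivT_add]; ring
  · simp only [Derivation.leibniz, smul_eq_mul, map_add, map_mul, derivT_mul]; ring
  · rw [partialD_C, expansion_C, derivT_C, map_zero, sub_zero]
  · by_cases h : i = j
    · subst h
      rw [partialD_X_self, expansion_X_self, derivT_add, derivT_C, derivT_single_one, map_one]
      ring
    · rw [partialD_X_of_ne h, expansion_X_of_ne h, derivT_C, map_zero, sub_zero]

/-- The Laurent expansion in powers of `x_j`. -/
noncomputable def expand (j : Fin r) : RatFun r →+* HahnSeries ℤ (RatFun r) :=
  expansion j (0 : RatFun r)

theorem coeff_expand_X_mul (j : Fin r) (φ : RatFun r) (n : ℤ) :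
    (expand j (ofPoly r (X j) * φ)).coeff n = (expand j φ).coeff (n - 1) := by
  rw [map_mul, expand, expansion_X_self, map_zero, zero_add, HahnSeries.coeff_single_mul, one_mul]

theorem coeff_expand_X_mul_of_ne {i j : Fin r} (h : i ≠ j) (φ : RatFun r) (n : ℤ) :
    (expand j (ofPoly r (X i) * φ)).coeff n = ofPoly r (X i) * (expand j φ).coeff n := by
  rw [map_mul, expand, expansion_X_of_ne h, coeff_C_mul', Algebra.algebraMap_self, RingHom.id_apply]

theorem coeff_expand_partialD_self (j : Fin r) (φ : RatFun r) (n : ℤ) :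
    (expand j (partialD j φ)).coeff n = ((n : RatFun r) + 1) * (expand j φ).coeff (n + 1) := by
  rw [expand, expansion_partialD, coeff_derivT]

theorem coeffwise_partialD_mul (i : Fin r) (f g : HahnSeries ℤ (RatFun r)) :
    coeffwise (fun _ => partialD i) (fun _ => map_zero _) (f * g) =
      f * coeffwise (fun _ => partialD i) (fun _ => map_zero _) g +
      coeffwise (fun _ => partialD i) (fun _ => map_zero _) f * g :=
  coeffwise_mul _ _ (fun _ a b => map_add _ a b)
    (fun _ _ a b => by rw [Derivation.leibniz]; simp only [smul_eq_mul]; ring) f g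

theorem coeffwise_partialD_add (i : Fin r) (f g : HahnSeries ℤ (RatFun r)) :
    coeffwise (fun _ => partialD i) (fun _ => map_zero _) (f + g) =
      coeffwise (fun _ => partialD i) (fun _ => map_zero _) f +
      coeffwise (fun _ => partialD i) (fun _ => map_zero _) g := by
  ext n; simp only [coeff_coeffwise, HahnSeries.coeff_add, map_add]

theorem coeffwise_partialD_C (i : Fin r) (c : RatFun r) :
    coeffwise (fun _ => partialD i) (fun _ => map_zero _) (HahnSeries.C c) =
      HahnSeries.C (partialD i c) := by
  ext n
  simp only [coeff_coeffwise, HahnSeries.C_apply, HahnSeries.coeff_single]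
  split_ifs <;> simp

theorem coeffwise_partialD_single (i : Fin r) :
    coeffwise (fun _ => partialD i) (fun _ => map_zero _)
      (HahnSeries.single 1 1 : HahnSeries ℤ (RatFun r)) = 0 := by
  ext n
  simp only [coeff_coeffwise, HahnSeries.coeff_single]
  split_ifs <;> simp

theorem coeff_expand_partialD {i j : Fin r} (h : i ≠ j) (φ : RatFun r) (n : ℤ) :
    (expand j (partialD i φ)).coeff n = partialD i ((expand j φ).coeff n) := by
  suffices hs : expand j (partialD i φ) -
      coeffwise (fun _ => partialD i) (fun _ => map_zero _) (expand j φ) = 0 by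
    rw [sub_eq_zero.1 hs, coeff_coeffwise]
  refine eq_zero_of_leibniz (expand j) (fun φ => expand j (partialD i φ) -
    coeffwise (fun _ => partialD i) (fun _ => map_zero _) (expand j φ))
    (fun φ ψ => ?_) (fun φ ψ => ?_) (fun c => ?_) (fun k => ?_) φ
  · simp only [map_add, coeffwise_partialD_add]; ring
  · simp only [Derivation.leibniz, smul_eq_mul, map_add, map_mul, coeffwise_partialD_mul]; ring
  · rw [partialD_C, expand, expansion_C, coeffwise_partialD_C, Algebra.algebraMap_self,
      RingHom.id_apply, partialD_C, map_zero, map_zero, sub_zero]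
  · by_cases hk : k = j
    · subst hk
      rw [partialD_X_of_ne h.symm, expand, expansion_X_self, map_zero, map_zero, zero_add,
        coeffwise_partialD_single, sub_zero]
    · rw [expand, expansion_X_of_ne hk, coeffwise_partialD_C, Algebra.algebraMap_self,
        RingHom.id_apply, sub_eq_zero]
      by_cases hki : k = i
      · subst hki; rw [partialD_X_self, map_one, map_one]
      · rw [partialD_X_of_ne hki, map_zero, map_zero]

/-- The coefficients do not involve `x_j`, although they are kept in the same field `RatFun r`; this
lets the elimination be iterated without changing the ring. -/
theorem partialD_coeff_expand (j : Fin r) (φ : RatFun r) (n : ℤ) :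
    partialD j ((expand j φ).coeff n) = 0 := by
  suffices hs : coeffwise (fun _ => partialD j) (fun _ => map_zero _) (expand j φ) = 0 by
    exact congrArg (fun f => f.coeff n) hs
  refine eq_zero_of_leibniz (expand j) (fun φ =>
    coeffwise (fun _ => partialD j) (fun _ => map_zero _) (expand j φ))
    (fun φ ψ => ?_) (fun φ ψ => ?_) (fun c => ?_) (fun k => ?_) φ
  · simp only [map_add, coeffwise_partialD_add]
  · simp only [map_mul, coeffwise_partialD_mul]
  · rw [expand, expansion_C, coeffwise_partialD_C, Algebra.algebraMap_self,
      RingHom.id_apply, partialD_C, map_zero]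
  · by_cases hk : k = j
    · subst hk
      rw [expand, expansion_X_self, map_zero, zero_add, coeffwise_partialD_single]
    · rw [expand, expansion_X_of_ne hk, coeffwise_partialD_C, Algebra.algebraMap_self,
        RingHom.id_apply, partialD_X_of_ne hk, map_zero]

end Expansion

/-! ### Rational solutions of the ordinary equation in one variable. -/

section OrdinaryEquation

variable {r : ℕ}

/-- The Euler operator `x_j ∂/∂x_j`. -/
noncomputable def theta (j : Fin r) (φ : RatFun r) : RatFun r := ofPoly r (X j) * partialD j φ

theorem expansion_theta {F : Type*} [Field F] [Algebra (RatFun r) F] (j : Fin r) (a : F)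
    (φ : RatFun r) : expansion j a (theta j φ) = thetaAt a (expansion j a φ) := by
  rw [theta, map_mul, expansion_X_self, expansion_partialD, thetaAt]

theorem expansion_iterate_partialD {F : Type*} [Field F] [Algebra (RatFun r) F] (j : Fin r) (a : F)
    (d : ℕ) (φ : RatFun r) :
    expansion j a ((partialD j)^[d] φ) = derivT^[d] (expansion j a φ) := by
  induction d generalizing φ with
  | zero => rfl
  | succ d ih => rw [Function.iterate_succ_apply, ih, expansion_partialD,
      Function.iterate_succ_apply]

theorem expansion_shiftedProd {F : Type*} [Field F] [Algebra (RatFun r) F] (j : Fin r) (a : F)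
    (e : ℕ → ℚ) (n : ℕ) (φ : RatFun r) :
    expansion j a (shiftedProd (theta j) (fun i => (e i : RatFun r)) n φ) =
      shiftedProd (thetaAt a) (fun i => HahnSeries.C (e i : F)) n (expansion j a φ) := by
  induction n with
  | zero => rfl
  | succ n ih =>
    rw [shiftedProd, map_add, expansion_theta, map_mul, ih, shiftedProd, map_ratCast, map_ratCast]

/-- At the origin `θ = T d/dT` is diagonal on powers of `T`. -/
theorem coeff_shiftedProd_thetaAt_zero {F : Type*} [Field F] (e : ℕ → F) (n : ℕ)
    (f : HahnSeries ℤ F) (k : ℤ) :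
    (shiftedProd (thetaAt 0) (fun i => HahnSeries.C (e i)) n f).coeff k =
      (∏ i ∈ Finset.range n, ((k : F) + e i)) * f.coeff k := by
  induction n with
  | zero => simp [shiftedProd]
  | succ n ih =>
    rw [shiftedProd, HahnSeries.coeff_add, coeff_thetaAt, coeff_C_mul', ih, Finset.prod_range_succ]
    ring

theorem exists_mul_isCoprime {R : Type*} [EuclideanDomain R] (p q : R) (hq : q ≠ 0) :
    ∃ g a b : R, g ≠ 0 ∧ IsCoprime a b ∧ p = g * a ∧ q = g * b := by
  classical
  obtain ⟨a, ha⟩ := EuclideanDomain.gcd_dvd_left p q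
  obtain ⟨b, hb⟩ := EuclideanDomain.gcd_dvd_right p q
  have hg : EuclideanDomain.gcd p q ≠ 0 := fun h0 => hq (EuclideanDomain.gcd_eq_zero_iff.1 h0).2
  refine ⟨_, a, b, hg, ⟨EuclideanDomain.gcdA p q, EuclideanDomain.gcdB p q, ?_⟩, ha, hb⟩
  have h := EuclideanDomain.gcd_eq_gcd_ab p q
  refine mul_left_cancel₀ hg ?_
  linear_combination -h - EuclideanDomain.gcdA p q * ha - EuclideanDomain.gcdB p q * hb

/-- A rational function whose expansions in `x_j` have no poles is a polynomial in `x_j`. -/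
theorem exists_polynomial_of_no_poles {F : Type*} [Field F] [Algebra (RatFun r) F] [IsAlgClosed F]
    (j : Fin r) (φ : RatFun r)
    (h : ∀ a : F, ∀ n < 0, (expansion j a φ).coeff n = 0) :
    ∃ G : Polynomial F, expansion j (0 : F) φ = HahnSeries.ofPowerSeries ℤ F G := by
  obtain ⟨p, q, hq, rfl⟩ := exists_frac φ
  have hQ : toUnivariate F j q ≠ 0 := (map_ne_zero_iff _ (toUnivariate_injective F j)).2 hq
  obtain ⟨g, P, Q, hg, hPQ, hgP, hgQ⟩ : ∃ g P Q : Polynomial F, g ≠ 0 ∧ IsCoprime P Q ∧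
      toUnivariate F j p = g * P ∧ toUnivariate F j q = g * Q := by
    exact exists_mul_isCoprime _ _ hQ
  have hev : ∀ a : F, HahnSeries.ofPowerSeries ℤ F (taylorSeries a P) =
      HahnSeries.ofPowerSeries ℤ F (taylorSeries a Q) *
        expansion j a (ofPoly r p / ofPoly r q) := by
    intro a
    have h1 : expansion j a (ofPoly r p) =
        expansion j a (ofPoly r q) * expansion j a (ofPoly r p / ofPoly r q) := by
      rw [← map_mul, mul_div_cancel₀ _ (ofPoly_ne_zero hq)]
    rw [expansion_ofPoly, expansion_ofPoly, hgP, hgQ, map_mul, map_mul, map_mul, map_mul,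
      mul_assoc] at h1
    refine mul_left_cancel₀ ?_ h1
    rw [Ne, map_eq_zero_iff _ HahnSeries.ofPowerSeries_injective,
      map_eq_zero_iff _ (taylorSeries_injective a)]
    exact hg
  -- Without a pole at `a`, the expansion of `P` is that of `Q` times a power series, so a root of
  -- `Q` would be a root of the coprime `P`.
  have hroot : ∀ a : F, Q.eval a ≠ 0 := by
    intro a ha
    obtain ⟨s, hs⟩ := exists_powerSeries _ (h a)
    have h1 := hev a
    rw [← hs, ← map_mul] at h1
    have h2 := congrArg PowerSeries.constantCoeff (HahnSeries.ofPowerSeries_injective h1)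
    rw [map_mul, constantCoeff_taylorSeries, constantCoeff_taylorSeries, ha, zero_mul] at h2
    obtain ⟨u, v, huv⟩ := hPQ
    have h3 := congrArg (Polynomial.eval a) huv
    simp [h2, ha] at h3
  have hdeg : Q.degree = 0 := by
    by_contra hd
    obtain ⟨a, ha⟩ := IsAlgClosed.exists_root Q hd
    exact hroot a ha
  obtain ⟨u, hu⟩ : ∃ u, Q = Polynomial.C u := ⟨_, Polynomial.eq_C_of_degree_eq_zero hdeg⟩
  have hu0 : u ≠ 0 := fun h0 => hroot 0 (by rw [hu, h0]; simp)
  refine ⟨P * Polynomial.C u⁻¹, ?_⟩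
  have h1 := hev 0
  have hts : ∀ p : Polynomial F, taylorSeries 0 p = (p : PowerSeries F) := fun p => by
    rw [taylorSeries_apply, Polynomial.taylor_zero]
  have hQP : P * Polynomial.C u⁻¹ * Q = P := by
    rw [hu, mul_assoc, ← Polynomial.C_mul, inv_mul_cancel₀ hu0, map_one, mul_one]
  have hQ0 : HahnSeries.ofPowerSeries ℤ F (taylorSeries 0 Q) ≠ 0 := by
    rw [Ne, map_eq_zero_iff _ HahnSeries.ofPowerSeries_injective,
      map_eq_zero_iff _ (taylorSeries_injective 0)]
    rintro rfl
    exact hroot 0 (by simp)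
  refine mul_left_cancel₀ hQ0 (h1.symm.trans ?_)
  rw [← hts, ← map_mul, ← map_mul, mul_comm Q, hQP]

/-- A rational function annihilated by `c ∂^d - ∏ (θ + e i)` vanishes, if its poles are excluded
by their exponents. -/
theorem eq_zero_of_ordinary_equation (j : Fin r) (c : RatFun r) (hc : c ≠ 0)
    (hcj : ∀ a : AlgebraicClosure (RatFun r),
      expansion j a c = HahnSeries.C (algebraMap (RatFun r) (AlgebraicClosure (RatFun r)) c))
    (d : ℕ) (e : ℕ → ℚ) (hpos : ∀ i < d, 0 < e i)
    (hsum : ∀ M : ℤ, ∑ i ∈ Finset.range d, ((M : ℚ) - i + e i) ≠ 0) (φ : RatFun r)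
    (h : c * (partialD j)^[d] φ = shiftedProd (theta j) (fun i => (e i : RatFun r)) d φ) :
    φ = 0 := by
  by_contra hφ
  set F := AlgebraicClosure (RatFun r)
  have hchar : CharZero F := charZero_of_injective_algebraMap (algebraMap (RatFun r) F).injective
  have heq : ∀ a : F, HahnSeries.C (algebraMap (RatFun r) F c) * derivT^[d] (expansion j a φ) =
      shiftedProd (thetaAt a) (fun i => HahnSeries.C (e i : F)) d (expansion j a φ) := by
    intro a
    rw [← expansion_shiftedProd, ← h, map_mul, hcj, expansion_iterate_partialD]
  have hne : ∀ a : F, expansion j a φ ≠ 0 := fun a => (map_ne_zero _).2 hφ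
  obtain ⟨G, hG⟩ := exists_polynomial_of_no_poles (F := F) j φ fun a n hn => by
    by_contra hcoeff
    have hM : (expansion j a φ).order < 0 := by
      by_contra! hM
      exact hcoeff (HahnSeries.coeff_eq_zero_of_lt_order (by omega))
    refine hsum (expansion j a φ).order ?_
    have := order_of_pole a _ ((map_ne_zero (algebraMap (RatFun r) F)).2 hc) (fun i => (e i : F)) d
      (expansion j a φ) _ hM (fun i hi => HahnSeries.coeff_eq_zero_of_lt_order hi)
      (fun h0 => hne a (HahnSeries.coeff_order_eq_zero.1 h0)) (heq a)
    exact_mod_cast this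
  have hd : d ≠ 0 := by
    rintro rfl
    exact hsum 0 (by simp)
  have hG0 : G ≠ 0 := by
    rintro rfl
    exact hne 0 (by rw [hG]; simp)
  -- In the top degree of `G` the term `c ∂^d` contributes nothing.
  have hcoeff := congrArg (fun f => f.coeff (G.natDegree : ℤ)) (heq 0)
  rw [coeff_C_mul', coeff_iterate_derivT, coeff_shiftedProd_thetaAt_zero, hG,
    HahnSeries.ofPowerSeries_apply_coeff, ← Nat.cast_add, HahnSeries.ofPowerSeries_apply_coeff,
    Polynomial.coeff_coe, Polynomial.coeff_coe,
    Polynomial.coeff_eq_zero_of_natDegree_lt (by omega : G.natDegree < G.natDegree + d),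
    mul_zero, mul_zero, eq_comm, mul_eq_zero] at hcoeff
  rcases hcoeff with h0 | h0
  · obtain ⟨i, hi, h1⟩ := Finset.prod_eq_zero_iff.1 h0
    have h2 : (G.natDegree : ℚ) + e i = 0 := by exact_mod_cast h1
    have := hpos i (Finset.mem_range.1 hi)
    have h3 : (0 : ℚ) ≤ G.natDegree := Nat.cast_nonneg _
    linarith
  · exact hG0 (Polynomial.leadingCoeff_eq_zero.1 h0)

end OrdinaryEquation

/-! ### Reduction of the three-variable system to an ordinary equation. -/

section ThreeVariables

variable {r : ℕ}

theorem theta_add (j : Fin r) (φ ψ : RatFun r) : theta j (φ + ψ) = theta j φ + theta j ψ := by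
  simp only [theta, map_add, mul_add]

theorem theta_mul (j : Fin r) (φ ψ : RatFun r) :
    theta j (φ * ψ) = φ * theta j ψ + theta j φ * ψ := by
  simp only [theta, Derivation.leibniz, smul_eq_mul]; ring

theorem partialD_ratCast (j : Fin r) (q : ℚ) : partialD j (q : RatFun r) = 0 := by
  rw [← map_ratCast (algebraMap ℂ (RatFun r)), Derivation.map_algebraMap]

theorem theta_ratCast_mul (j : Fin r) (q : ℚ) (φ : RatFun r) :
    theta j (q * φ) = q * theta j φ := by
  rw [theta_mul, theta, theta, partialD_ratCast]; ring

theorem theta_comm (i j : Fin r) (φ : RatFun r) :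
    theta i (theta j φ) = theta j (theta i φ) := by
  by_cases h : i = j
  · rw [h]
  · simp only [theta, Derivation.leibniz, smul_eq_mul, partialD_comm i j,
      partialD_X_of_ne h, partialD_X_of_ne (Ne.symm h)]
    ring

/-- The classical identity `x^n ∂^n = θ (θ - 1) ⋯ (θ - n + 1)`. -/
theorem X_pow_mul_iterate_partialD (j : Fin r) (n : ℕ) (φ : RatFun r) :
    ofPoly r (X j) ^ n * (partialD j)^[n] φ =
      shiftedProd (theta j) (fun i => ((-i : ℚ) : RatFun r)) n φ := by
  induction n with
  | zero => simp [shiftedProd]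
  | succ n ih =>
    rw [shiftedProd, ← ih, Function.iterate_succ_apply', theta, Derivation.leibniz,
      Derivation.leibniz_pow, partialD_X_self]
    simp only [smul_eq_mul, nsmul_eq_mul, mul_one]
    push_cast
    rcases n with _ | n
    · simp
    · rw [Nat.add_sub_cancel]; ring

/-- An additive operator commuting with `θ_j` and with rational scalars commutes with
`∏ (θ_j + e i)`. -/
theorem map_shiftedProd (j : Fin r) (e : ℕ → ℚ) (T : RatFun r → RatFun r)
    (hadd : ∀ φ ψ, T (φ + ψ) = T φ + T ψ) (hθ : ∀ φ, T (theta j φ) = theta j (T φ))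
    (hq : ∀ (q : ℚ) φ, T (q * φ) = q * T φ) (n : ℕ) (φ : RatFun r) :
    T (shiftedProd (theta j) (fun i => (e i : RatFun r)) n φ) =
      shiftedProd (theta j) (fun i => (e i : RatFun r)) n (T φ) := by
  induction n with
  | zero => rfl
  | succ n ih => rw [shiftedProd, hadd, hθ, hq, ih, shiftedProd]

theorem shiftedProd_append (j : Fin r) (e e' : ℕ → ℚ) (p q : ℕ) (φ : RatFun r) :
    shiftedProd (theta j) (fun i => (e i : RatFun r)) p
        (shiftedProd (theta j) (fun i => (e' i : RatFun r)) q φ) =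
      shiftedProd (theta j)
        (fun i => ((if i < q then e' i else e (i - q) : ℚ) : RatFun r)) (q + p) φ := by
  induction p with
  | zero =>
    have : ∀ n ≤ q, shiftedProd (theta j) (fun i => (e' i : RatFun r)) n φ = shiftedProd (theta j)
        (fun i => ((if i < q then e' i else e (i - q) : ℚ) : RatFun r)) n φ := by
      intro n hn
      induction n with
      | zero => rfl
      | succ n ih => rw [shiftedProd, shiftedProd, ih (by omega), if_pos (by omega)]
    exact this q le_rfl
  | succ p ih =>
    rw [shiftedProd, ih, ← add_assoc, shiftedProd, if_neg (by omega), Nat.add_sub_cancel_left]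

/-- All Euler operators commute, so an affine relation between `θ_z` and `θ_j` on `φ` persists after
applying polynomials in `θ_j`. -/
theorem relation_shiftedProd (z j : Fin r) (e : ℕ → ℚ) (s t : ℚ) (n : ℕ) (φ : RatFun r)
    (h : theta z φ = s * (theta j φ + t * φ)) :
    theta z (shiftedProd (theta j) (fun i => (e i : RatFun r)) n φ) =
      s * (theta j (shiftedProd (theta j) (fun i => (e i : RatFun r)) n φ) +
        t * shiftedProd (theta j) (fun i => (e i : RatFun r)) n φ) := by
  rw [map_shiftedProd j e (theta z) (theta_add z) (theta_comm z j) (theta_ratCast_mul z), h]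
  refine (map_shiftedProd j e (fun φ => s * (theta j φ + t * φ)) (fun φ ψ => ?_) (fun φ => ?_)
    (fun q φ => ?_) n φ).symm
  · simp only [theta_add]; ring
  · simp only [theta_add, theta_ratCast_mul]
  · simp only [theta_ratCast_mul]; ring

/-- Each factor becomes `θ_z - i = s (θ_j + t - i / s)`. -/
theorem shiftedProd_of_relation (z j : Fin r) (s t : ℚ) (hs : s ≠ 0) (n : ℕ) (φ : RatFun r)
    (h : theta z φ = s * (theta j φ + t * φ)) :
    shiftedProd (theta z) (fun i => ((-i : ℚ) : RatFun r)) n φ =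
      ((s ^ n : ℚ) : RatFun r) *
        shiftedProd (theta j) (fun i => ((t - i / s : ℚ) : RatFun r)) n φ := by
  induction n with
  | zero => simp [shiftedProd]
  | succ n ih =>
    have hs' : (s : RatFun r) ≠ 0 := by exact_mod_cast hs
    rw [shiftedProd, ih, theta_ratCast_mul, relation_shiftedProd z j _ s t n φ h, shiftedProd]
    push_cast
    field_simp
    ring

theorem iterate_partialD_X_pow_mul {i j : Fin r} (h : i ≠ j) (m n : ℕ) (φ : RatFun r) :
    (partialD j)^[n] (ofPoly r (X i) ^ m * φ) = ofPoly r (X i) ^ m * (partialD j)^[n] φ := by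
  induction n with
  | zero => rfl
  | succ n ih =>
    rw [Function.iterate_succ_apply', ih, Derivation.leibniz, Derivation.leibniz_pow,
      partialD_X_of_ne h, Function.iterate_succ_apply']
    simp

theorem sum_range_affine (a b : ℚ) (n : ℕ) :
    ∑ i ∈ Finset.range n, (a + b * i) = n * a + b * (n * (n - 1) / 2) := by
  induction n with
  | zero => simp
  | succ n ih => rw [Finset.sum_range_succ, ih]; push_cast; ring

/-- There is no nonzero rational solution of the system in the three variables `x_z, x_j, x_l` of
weights `0, q, p + q`. -/
theorem eq_zero_of_three_variables {z j l : Fin r} (hzj : z ≠ j) (hlj : l ≠ j) (hlz : l ≠ z)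
    (p q : ℕ) (hp : 0 < p) (hq : 0 < q) (a b : ℤ) (hab : ((p + q : ℕ) : ℤ) * a < b) (hb : b < 0)
    (φ : RatFun r)
    (htoric : (partialD j)^[q + p] φ = (partialD z)^[p] ((partialD l)^[q] φ))
    (h1 : theta z φ + theta j φ + theta l φ = a * φ)
    (h2 : q * theta j φ + (p + q : ℕ) * theta l φ = b * φ) :
    φ = 0 := by
  have hp' : (0 : ℚ) < p := by exact_mod_cast hp
  have hq' : (0 : ℚ) < q := by exact_mod_cast hq
  have hpK : (p : RatFun r) ≠ 0 := by exact_mod_cast hp.ne'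
  have hqK : (q : RatFun r) ≠ 0 := by exact_mod_cast hq.ne'
  have hdK : (p : RatFun r) + q ≠ 0 := by exact_mod_cast (by omega : p + q ≠ 0)
  have hab' : (0 : ℚ) < b - (p + q) * a := by
    have : ((p + q : ℕ) : ℚ) * a < b := by exact_mod_cast hab
    push_cast at this
    linarith
  have hb' : (0 : ℚ) < -b := by
    have : (b : ℚ) < 0 := by exact_mod_cast hb
    linarith
  push_cast at h2
  -- These come from solving the two Euler equations for `θ_z` and `θ_l`. The cone inequalities are
  -- `0 < t` and `0 < t'`, while `s` and `s'` are negative, so the shifts `t - i / s` and `t' - i /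
  -- s'` are positive.
  let s : ℚ := -(p / (p + q))
  let t : ℚ := (b - (p + q) * a) / p
  let s' : ℚ := -(q / (p + q))
  let t' : ℚ := -b / q
  have hs : s ≠ 0 := neg_ne_zero.2 (by positivity)
  have hs' : s' ≠ 0 := neg_ne_zero.2 (by positivity)
  have hl : theta l φ = s' * (theta j φ + t' * φ) := by
    simp only [s', t']
    push_cast
    field_simp
    linear_combination h2
  have hz : theta z φ = s * (theta j φ + t * φ) := by
    simp only [s, t]
    push_cast
    field_simp
    linear_combination (p + q : RatFun r) * h1 - h2
  have hode : ofPoly r (X z) ^ p * ofPoly r (X l) ^ q * (partialD j)^[q + p] φ =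
      ((s ^ p * s' ^ q : ℚ) : RatFun r) * shiftedProd (theta j)
        (fun i => ((if i < q then t' - i / s' else t - (i - q : ℕ) / s : ℚ) : RatFun r))
          (q + p) φ := by
    rw [← shiftedProd_append j (fun i => t - i / s) (fun i => t' - i / s'), htoric, mul_assoc,
      ← iterate_partialD_X_pow_mul hlz, X_pow_mul_iterate_partialD l,
      shiftedProd_of_relation l j s' t' hs' q φ hl, X_pow_mul_iterate_partialD z,
      ← map_shiftedProd z (fun i => -i) (fun φ => ((s' ^ q : ℚ) : RatFun r) * φ)
        (fun φ ψ => mul_add _ _ _) (fun φ => (theta_ratCast_mul z _ φ).symm)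
        (fun q φ => by ring),
      shiftedProd_of_relation z j s t hs p _ (relation_shiftedProd z j _ s t q φ hz)]
    push_cast
    ring
  have hu : ((s ^ p * s' ^ q : ℚ) : RatFun r) ≠ 0 := by
    exact_mod_cast mul_ne_zero (pow_ne_zero p hs) (pow_ne_zero q hs')
  refine eq_zero_of_ordinary_equation j
    (((s ^ p * s' ^ q : ℚ) : RatFun r)⁻¹ * (ofPoly r (X z) ^ p * ofPoly r (X l) ^ q))
    (mul_ne_zero (inv_ne_zero hu) (mul_ne_zero (pow_ne_zero _ (ofPoly_ne_zero (X_ne_zero z)))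
      (pow_ne_zero _ (ofPoly_ne_zero (X_ne_zero l))))) (fun a => ?_) (q + p)
    (fun i => if i < q then t' - i / s' else t - (i - q : ℕ) / s) (fun i _ => ?_)
    (fun M hM => ?_) φ ?_
  · simp only [map_mul, map_pow, map_inv₀, map_ratCast, expansion_X_of_ne hzj,
      expansion_X_of_ne hlj]
  · have ht : 0 < t := by positivity
    have ht' : 0 < t' := by positivity
    have hns : ∀ k : ℕ, (k : ℚ) / s ≤ 0 := fun k =>
      div_nonpos_of_nonneg_of_nonpos k.cast_nonneg (neg_nonpos.2 (by positivity))
    have hns' : ∀ k : ℕ, (k : ℚ) / s' ≤ 0 := fun k =>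
      div_nonpos_of_nonneg_of_nonpos k.cast_nonneg (neg_nonpos.2 (by positivity))
    split_ifs
    · linarith [hns' i]
    · linarith [hns (i - q)]
  · have e1 : ∀ i ∈ Finset.range q,
        ((M : ℚ) - i + if i < q then t' - i / s' else t - (i - q : ℕ) / s) =
          (M + t') + (-1 - 1 / s') * i := by
      intro i hi
      rw [if_pos (Finset.mem_range.1 hi)]; ring
    have e2 : ∀ i ∈ Finset.range p, ((M : ℚ) - (q + i : ℕ) +
        if q + i < q then t' - (q + i : ℕ) / s' else t - (q + i - q : ℕ) / s) =
          (M - q + t) + (-1 - 1 / s) * i := by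
      intro i _
      rw [if_neg (by omega), Nat.add_sub_cancel_left]; push_cast; ring
    rw [Finset.sum_range_add, Finset.sum_congr rfl e1, Finset.sum_congr rfl e2,
      sum_range_affine, sum_range_affine] at hM
    simp only [s, t, s', t'] at hM
    field_simp at hM
    -- The sum of the two arithmetic progressions is `(p + q) (2M - 2a - 1) / 2`; parity excludes
    -- its vanishing.
    have h3 : (p + q : ℚ) * (2 * M - 2 * a - 1) = 0 := by linear_combination hM
    have h4 := (mul_eq_zero.1 h3).resolve_left (by positivity)
    have h5 : 2 * M - 2 * a - 1 = 0 := by exact_mod_cast h4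
    omega
  · rw [mul_assoc, hode, inv_mul_cancel_left₀ hu]

end ThreeVariables

/-! ### Elimination of one variable by passing to the lowest coefficient. -/

section Elimination

variable {r : ℕ}

/-- A solution of the equations that remain when the variables in `S` have been eliminated from the
system with weights `w`, where `x_z` has weight `0` and `x_l` has weight `d`. -/
structure IsReducedSolution (z l : Fin r) (w : Fin r → ℕ) (d : ℕ) (S : Finset (Fin r)) (a b : ℤ)
    (φ : RatFun r) : Prop where
  toric : ∀ j ∉ S, j ≠ z → j ≠ l →
    (partialD j)^[d] φ = (partialD z)^[d - w j] ((partialD l)^[w j] φ)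
  const : ∀ j ∈ S, partialD j φ = 0
  degree : ∑ i, theta i φ = a • φ
  weight : ∑ i, w i • theta i φ = b • φ

theorem coeff_expand_iterate_partialD {i j : Fin r} (h : i ≠ j) (m : ℕ) (φ : RatFun r) (n : ℤ) :
    (expand j ((partialD i)^[m] φ)).coeff n = (partialD i)^[m] ((expand j φ).coeff n) := by
  induction m with
  | zero => rfl
  | succ m ih => rw [Function.iterate_succ_apply', coeff_expand_partialD h, ih,
      Function.iterate_succ_apply']

/-- For `i = j` the first summand is zero. Keeping it lets the Euler sums over all variables retain
their shape, with only the exponent shifted. -/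
theorem coeff_expand_theta (i j : Fin r) (φ : RatFun r) (n : ℤ) :
    (expand j (theta i φ)).coeff n =
      theta i ((expand j φ).coeff n) + if i = j then n • (expand j φ).coeff n else 0 := by
  by_cases h : i = j
  · subst h
    rw [theta, coeff_expand_X_mul, coeff_expand_partialD_self, theta, partialD_coeff_expand,
      if_pos rfl, zsmul_eq_mul]
    push_cast
    simp
  · rw [theta, coeff_expand_X_mul_of_ne h, coeff_expand_partialD h, if_neg h, add_zero, theta]

/-- The lowest coefficient in `x_j` of a reduced solution is again one. -/
theorem IsReducedSolution.eliminate {z l : Fin r} {w : Fin r → ℕ} {d : ℕ} (hd : 0 < d)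
    {S : Finset (Fin r)} {a b : ℤ} {φ : RatFun r} (h : IsReducedSolution z l w d S a b φ)
    (hφ : φ ≠ 0) {j : Fin r} (hjS : j ∉ S) (hjz : j ≠ z) (hjl : j ≠ l) :
    ∃ (n : ℕ) (ψ : RatFun r), ψ ≠ 0 ∧
      IsReducedSolution z l w d (insert j S) (a - n) (b - n * w j) ψ := by
  have hne : expand j φ ≠ 0 := (map_ne_zero _).2 hφ
  obtain ⟨N, hN⟩ : ∃ N, (expand j φ).order = N := ⟨_, rfl⟩
  have hc : (expand j φ).coeff N ≠ 0 := fun h0 =>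
    hne (HahnSeries.coeff_order_eq_zero.1 (hN ▸ h0))
  have hlow : ∀ i < N, (expand j φ).coeff i = 0 := fun i hi =>
    HahnSeries.coeff_eq_zero_of_lt_order (hN ▸ hi)
  -- In degree `N - d` the right side of the toric equation vanishes by minimality of `N`, and the
  -- left side is `N (N - 1) ⋯ (N - d + 1)` times the lowest coefficient. Hence `N` is one of `0, …,
  -- d - 1`.
  have hN0 : 0 ≤ N := by
    have h1 := congrArg (fun f => (expand j f).coeff (N - d)) (h.toric j hjS hjz hjl)
    rw [coeff_expand_iterate_partialD hjz.symm, coeff_expand_iterate_partialD hjl.symm,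
      hlow _ (by omega), iterate_map_zero, iterate_map_zero, expand, expansion_iterate_partialD,
      coeff_iterate_derivT, sub_add_cancel] at h1
    obtain ⟨i, -, hi⟩ := Finset.prod_eq_zero_iff.1 ((mul_eq_zero.1 h1).resolve_right hc)
    push_cast at hi
    have hi' : N - d + d - (i : ℤ) = 0 := by exact_mod_cast hi
    omega
  lift N to ℕ using hN0
  refine ⟨N, _, hc, ⟨fun i hi hiz hil => ?_, fun i hi => ?_, ?_, ?_⟩⟩
  · rw [Finset.mem_insert, not_or] at hi
    rw [← coeff_expand_iterate_partialD hi.1, h.toric i hi.2 hiz hil,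
      coeff_expand_iterate_partialD hjz.symm, coeff_expand_iterate_partialD hjl.symm]
  · by_cases hij : i = j
    · rw [hij, partialD_coeff_expand]
    · rw [← coeff_expand_partialD hij, h.const i ((Finset.mem_insert.1 hi).resolve_left hij),
        map_zero, HahnSeries.coeff_zero]
  · have h1 := congrArg (fun f => (expand j f).coeff N) h.degree
    simp only [map_sum, map_zsmul, HahnSeries.coeff_sum, HahnSeries.coeff_smul,
      coeff_expand_theta, Finset.sum_add_distrib, Finset.sum_ite_eq', Finset.mem_univ,
      if_true] at h1
    rw [sub_smul, ← h1, natCast_zsmul, add_sub_cancel_right]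
  · have h1 := congrArg (fun f => (expand j f).coeff N) h.weight
    simp only [map_sum, map_zsmul, map_nsmul, HahnSeries.coeff_sum, HahnSeries.coeff_smul,
      coeff_expand_theta, smul_add, smul_ite, smul_zero, Finset.sum_add_distrib,
      Finset.sum_ite_eq', Finset.mem_univ, if_true] at h1
    rw [sub_smul, ← h1, mul_comm, mul_smul, natCast_zsmul, natCast_zsmul, add_sub_cancel_right]

end Elimination

/-! ### From the full system of the monomial curve to three variables. -/

section MonomialCurve

variable {r : ℕ}

theorem IsReducedSolution.eliminate_finset {z l : Fin r} {w : Fin r → ℕ} {d : ℕ} (hd : 0 < d)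
    (hw : ∀ i, w i ≤ d) {a b : ℤ} (hab : d * a < b) (hb : b < 0) {φ : RatFun r}
    (h : IsReducedSolution z l w d ∅ a b φ) (hφ : φ ≠ 0) (S : Finset (Fin r))
    (hz : z ∉ S) (hl : l ∉ S) :
    ∃ (a b : ℤ) (ψ : RatFun r), d * a < b ∧ b < 0 ∧ ψ ≠ 0 ∧
      IsReducedSolution z l w d S a b ψ := by
  induction S using Finset.induction_on with
  | empty => exact ⟨a, b, φ, hab, hb, hφ, h⟩
  | insert j S hjS ih =>
    rw [Finset.mem_insert, not_or] at hz hl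
    obtain ⟨a, b, ψ, hab, hb, hψ, h⟩ := ih hz.2 hl.2
    obtain ⟨n, ψ', hψ', h'⟩ := h.eliminate hd hψ hjS (Ne.symm hz.1) (Ne.symm hl.1)
    -- With `0 ≤ n * w j`, this keeps `(a - n, b - n * w j)` in the cone.
    have hn : (n : ℤ) * w j ≤ n * d := by exact_mod_cast Nat.mul_le_mul_left n (hw j)
    have hn' : (0 : ℤ) ≤ n * w j := by positivity
    exact ⟨_, _, ψ', by linarith, by linarith, hψ', h'⟩

theorem IsReducedSolution.eq_zero {z l j : Fin r} (hjz : j ≠ z) (hjl : j ≠ l) (hlz : l ≠ z)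
    {w : Fin r → ℕ} {d : ℕ} (hw : ∀ i, w i ≤ d) (hwz : w z = 0) (hwl : w l = d)
    (hwj : 0 < w j) (hwj' : w j < d) {a b : ℤ} (hab : d * a < b) (hb : b < 0) {φ : RatFun r}
    (h : IsReducedSolution z l w d ∅ a b φ) : φ = 0 := by
  by_contra hφ
  obtain ⟨a, b, ψ, hab, hb, hψ, h⟩ := h.eliminate_finset (by omega) hw hab hb hφ {z, j, l}ᶜ
    (by simp) (by simp)
  have hzero : ∀ i, i ∉ ({z, j, l} : Finset (Fin r)) → theta i ψ = 0 := fun i hi => by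
    rw [theta, h.const i (Finset.mem_compl.2 hi), mul_zero]
  have hsum : ∀ f : Fin r → RatFun r, (∀ i ∉ ({z, j, l} : Finset (Fin r)), f i = 0) →
      ∑ i, f i = f z + f j + f l := fun f hf => by
    rw [← Finset.sum_subset (Finset.subset_univ {z, j, l}) fun i _ hi => hf i hi,
      Finset.sum_insert (by simp [hjz.symm, hlz.symm]), Finset.sum_insert (by simpa using hjl),
      Finset.sum_singleton, add_assoc]
  have h1 := h.degree
  have h2 := h.weight
  rw [hsum _ hzero] at h1
  rw [hsum _ fun i hi => by rw [hzero i hi, nsmul_eq_mul, mul_zero]] at h2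
  have hd : d - w j + w j = d := by omega
  have hd' : w j + (d - w j) = d := by omega
  refine hψ (eq_zero_of_three_variables hjz.symm hjl.symm hlz (d - w j) (w j) (by omega) hwj a b
    (by rwa [hd]) hb ψ ?_ ?_ ?_)
  · rw [hd']
    exact h.toric j (by simp) hjz hjl
  · rw [h1, zsmul_eq_mul]
  · rw [hwz, hwl, zero_smul, zero_add, nsmul_eq_mul, nsmul_eq_mul, zsmul_eq_mul] at h2
    rw [hd, h2]

theorem prod_ofFn_eq_single {M : Type*} [Monoid M] {n : ℕ} (f : Fin n → M) (j : Fin n)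
    (h : ∀ i ≠ j, f i = 1) : (List.ofFn f).prod = f j := by
  induction n with
  | zero => exact j.elim0
  | succ n ih =>
    rw [List.ofFn_succ, List.prod_cons]
    refine Fin.cases (fun h => ?_) (fun j h => ?_) j h
    · rw [List.prod_eq_one, mul_one]
      intro x hx
      obtain ⟨i, rfl⟩ := List.mem_ofFn.1 hx
      exact h _ (Fin.succ_ne_zero i)
    · rw [h 0 (Fin.succ_ne_zero j).symm, one_mul]
      exact ih (fun i => f i.succ) j fun i hi => h _ fun h0 => hi (Fin.succ_injective _ h0)

theorem monomialD_apply_single (u : Fin r → ℕ) (j : Fin r) (h : ∀ i ≠ j, u i = 0)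
    (φ : RatFun r) : monomialD u φ = (partialD j)^[u j] φ := by
  rw [monomialD, prod_ofFn_eq_single _ j fun i hi => by rw [h i hi, pow_zero], Module.End.pow_apply]
  rfl

theorem monomialD_apply_zero_last {m : ℕ} (u : Fin (m + 2) → ℕ)
    (h : ∀ i, i ≠ 0 → i ≠ Fin.last (m + 1) → u i = 0) (φ : RatFun (m + 2)) :
    monomialD u φ =
      (partialD 0)^[u 0] ((partialD (Fin.last (m + 1)))^[u (Fin.last (m + 1))] φ) := by
  rw [monomialD, List.ofFn_succ, List.prod_cons, prod_ofFn_eq_single _ (Fin.last m),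
    Module.End.mul_apply, Module.End.pow_apply, Module.End.pow_apply]
  · rfl
  · intro i hi
    rw [h _ (Fin.succ_ne_zero i) fun h0 => hi (Fin.succ_injective _ h0), pow_zero]

/-- The weights `0, k_1, …, k_m, d` of the variables. -/
def curveWeight {m : ℕ} (k : Fin m → ℕ) (d : ℕ) : Fin (m + 2) → ℕ :=
  Fin.cons (α := fun _ => ℕ) 0 (Fin.snoc (α := fun _ => ℕ) k d)

theorem curveWeight_zero {m : ℕ} (k : Fin m → ℕ) (d : ℕ) : curveWeight k d 0 = 0 := rfl

theorem curveWeight_last {m : ℕ} (k : Fin m → ℕ) (d : ℕ) :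
    curveWeight k d (Fin.last (m + 1)) = d := by
  rw [curveWeight, ← Fin.succ_last, Fin.cons_succ, Fin.snoc_last]

theorem curveWeight_middle {m : ℕ} (k : Fin m → ℕ) (d : ℕ) (i : Fin m) :
    curveWeight k d i.castSucc.succ = k i := by
  rw [curveWeight, Fin.cons_succ, Fin.snoc_castSucc]

theorem curveWeight_le {m : ℕ} (k : Fin m → ℕ) (d : ℕ) (hk : ∀ i, k i < d) (i : Fin (m + 2)) :
    curveWeight k d i ≤ d := by
  refine Fin.cases (Nat.zero_le _) (fun i => ?_) i
  refine Fin.lastCases ?_ (fun i => ?_) i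
  · rw [Fin.succ_last, curveWeight_last]
  · rw [curveWeight_middle]; exact (hk i).le

theorem monomialCurveMatrix_one {m : ℕ} (k : Fin m → ℕ) (d : ℕ) (i : Fin (m + 2)) :
    monomialCurveMatrix k d 1 i = curveWeight k d i := by
  refine Fin.cases rfl (fun i => ?_) i
  refine Fin.lastCases ?_ (fun i => ?_) i
  · rw [Fin.succ_last, curveWeight_last, ← Fin.succ_last]; simp [monomialCurveMatrix]
  · rw [curveWeight_middle]; simp [monomialCurveMatrix]

theorem IsRationalSolution.isReducedSolution {m : ℕ} {k : Fin m → ℕ} {d : ℕ}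
    (hk : ∀ i, k i < d) {α : Fin 2 → ℤ} {φ : RatFun (m + 2)}
    (h : IsRationalSolution (monomialCurveMatrix k d) (fun i => (α i : ℂ)) φ) :
    IsReducedSolution 0 (Fin.last (m + 1)) (curveWeight k d) d ∅ (α 0) (α 1) φ := by
  have h0l : (0 : Fin (m + 2)) ≠ Fin.last (m + 1) := Fin.last_pos.ne
  refine ⟨fun j _ hj0 hjl => ?_, fun j hj => absurd hj (Finset.notMem_empty j), ?_, ?_⟩
  · set w := curveWeight k d with hw
    have hwd : w j ≤ d := curveWeight_le k d hk j
    -- The affine relation between the columns of weights `0`, `w j` and `d`.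
    let v : Fin (m + 2) → ℤ := Pi.single j (d : ℤ) - Pi.single 0 ((d : ℤ) - w j) -
      Pi.single (Fin.last (m + 1)) (w j : ℤ)
    have hv : ∀ i, v i = (if i = j then (d : ℤ) else 0) - (if i = 0 then (d : ℤ) - w j else 0) -
        (if i = Fin.last (m + 1) then (w j : ℤ) else 0) := fun i => by
      simp only [v, Pi.sub_apply, Pi.single_apply]
    have hker : (monomialCurveMatrix k d).mulVec v = 0 := by
      ext i
      simp only [v, Matrix.mulVec_sub, Matrix.mulVec_single, Pi.sub_apply, Pi.smul_apply,
        Matrix.col_apply, MulOpposite.smul_eq_mul_unop, MulOpposite.unop_op, Pi.zero_apply]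
      fin_cases i
      · simp [monomialCurveMatrix]
      · simp only [Fin.mk_one, monomialCurveMatrix_one, ← hw]
        rw [hw, curveWeight_zero, curveWeight_last, ← hw]
        push_cast; ring
    have ht := h.toric v hker
    rw [toricD, LinearMap.sub_apply, sub_eq_zero, monomialD_apply_single _ j,
      monomialD_apply_zero_last] at ht
    · rw [hv, hv, hv, if_pos rfl, if_neg hj0, if_neg hjl, if_neg hj0.symm, if_pos rfl, if_neg h0l,
        if_neg (Ne.symm hjl), if_neg h0l.symm, if_pos rfl] at ht
      have e1 : ((d : ℤ) - 0 - 0).toNat = d := by omega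
      have e2 : (-((0 : ℤ) - (d - w j) - 0)).toNat = d - w j := by omega
      have e3 : (-((0 : ℤ) - 0 - w j)).toNat = w j := by omega
      rwa [e1, e2, e3] at ht
    · intro i hi0 hil
      rw [hv, if_neg hi0, if_neg hil]
      split_ifs <;> omega
    · intro i hij
      rw [hv, if_neg hij]
      split_ifs <;> omega
  · have h1 := h.euler 0
    have hα : ((α 0 : ℂ)) • φ = α 0 • φ := Int.cast_smul_eq_zsmul ℂ _ _
    rw [← hα, ← h1]
    refine Finset.sum_congr rfl fun i _ => ?_
    simp [monomialCurveMatrix, theta]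
  · have h1 := h.euler 1
    have hα : ((α 1 : ℂ)) • φ = α 1 • φ := Int.cast_smul_eq_zsmul ℂ _ _
    rw [← hα, ← h1]
    refine Finset.sum_congr rfl fun i _ => ?_
    rw [monomialCurveMatrix_one, theta, nsmul_eq_mul, Int.cast_natCast, mul_assoc]

end MonomialCurve

end AHypergeometric

theorem theorem1p9 (m : ℕ) (hm : 1 ≤ m) (k : Fin m → ℕ) (d : ℕ)
    (hk_pos : ∀ i, 0 < k i) (hk_mono : StrictMono k) (hk_lt : ∀ i, k i < d)
    (hgcd : Nat.gcd (Finset.univ.gcd k) d = 1)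
    (α : Fin 2 → ℤ) (hα : α ∈ AHypergeometric.eulerJacobiCone d)
    (φ : AHypergeometric.RatFun (m + 2))
    (hφ : AHypergeometric.IsRationalSolution (AHypergeometric.monomialCurveMatrix k d)
      (fun i => (α i : ℂ)) φ) :
    φ = 0 := by
  have h0l : Fin.last (m + 1) ≠ (0 : Fin (m + 2)) := Fin.last_pos.ne'
  -- Any intermediate variable may be the one that is kept; `1 ≤ m` provides one.
  let i : Fin m := ⟨0, hm⟩
  refine (hφ.isReducedSolution hk_lt).eq_zero (j := i.castSucc.succ) (Fin.succ_ne_zero _) ?_ h0l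
    (AHypergeometric.curveWeight_le k d hk_lt) (AHypergeometric.curveWeight_zero k d)
    (AHypergeometric.curveWeight_last k d) ?_ ?_ hα.1 hα.2
  · rw [← Fin.succ_last]
    exact fun h => (Fin.castSucc_lt_last i).ne (Fin.succ_injective _ h)
  · rw [AHypergeometric.curveWeight_middle]; exact hk_pos i
  · rw [AHypergeometric.curveWeight_middle]; exact hk_lt i
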